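/- Let $\alpha=(\alpha_1,\dots,\alpha_k)$ be an integer composition of $n>0$, and let $\max(\alpha)$ be its largest part. Definitions. Split the nodes $1,\dots,n$ from left to right into consecutive blocks of sizes $\alpha_1,\dots,\alpha_k$, the $\alpha$-regions. An $\alpha$-arc is a pair $w_{a,b}=(a,b)$ with $1\le a<b\le n$ and $a,b$ in different $\alpha$-regions. Let $G_\alpha$ be the directed graph whose vertices are the $\alpha$-arcs, with an edge $w_{a_1,b_1}\to w_{a_2,b_2}$ between different $\alpha$-arcs if either $a_1,a_2$ are in the same $\alpha$-region and $a_1\le a_2<b_2\le b_1$, or $a_1,a_2$ are in different $\alpha$-regions, $a_2<a_1<b_2\le b_1$, and $a_1,b_2$ are in different $\alpha$-regions. A finite lattice $L$ is extremal if its length (one less than the maximum number of elements of a chain) equals both the number of its join-irreducible elements (those covering exactly one element) and the number of its meet-irreducible elements (those covered by exactly one element). In that case a longest chain $\hat 0=x_0\lessdot x_1\lessdot\dots\lessdot x_N=\hat 1$ numbers the join-irreducibles $j_1,\dots,j_N$ and the meet-irreducibles $m_1,\dots,m_N$ in such a way that $x_i=j_1\vee\dots\vee j_i=m_{i+1}\wedge\dots\wedge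 m_N$ for all $0\le i\le N$. The Galois graph of $L$ is the directed graph on the join-irreducibles with an edge $j_i\to j_l$ whenever $i\ne l$ and $j_i\not\le m_l$. The parabolic Tamari lattice $\mathrm{Tam}(\alpha)$ is a finite extremal lattice whose Galois graph is isomorphic to $G_\alpha$. The order dimension of a poset $P$ is the smallest integer $d\ge 0$ such that $P$ is isomorphic to a subposet of $\mathbb{R}^d$ with the componentwise order. Proposition. Such a lattice exists, and every such lattice has order dimension $$\dim(\mathrm{Tam}(\alpha))=n-\max(\alpha).$$ -/

import Mathlib

/-- `d` is the order dimension of the poset `P`: the smallest natural number such that `P` is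
isomorphic to a subposet of `ℝ^d` with the componentwise order. -/
def HasOrderDimension (P : Type*) [PartialOrder P] (d : ℕ) : Prop :=
  IsLeast {k : ℕ | Nonempty (P ↪o (Fin k → ℝ))} d

/-- The join-irreducible elements: those that cover exactly one element. -/
def JoinIrr (L : Type*) [Lattice L] : Set L := {j | ∃! x, x ⋖ j}

/-- The meet-irreducible elements: those that are covered by exactly one element. -/
def MeetIrr (L : Type*) [Lattice L] : Set L := {m | ∃! y, m ⋖ y}

/-- A (finite) lattice is extremal if its length, the maximum of the lengths of its chains
(a chain of `k + 1` elements has length `k`), equals both the number of join-irreducible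
and the number of meet-irreducible elements. -/
def IsExtremalLattice (L : Type*) [Lattice L] : Prop :=
  Order.krullDim L = ((JoinIrr L).ncard : ℕ∞) ∧ Order.krullDim L = ((MeetIrr L).ncard : ℕ∞)

/-- A maximal chain `x 0 ⋖ x 1 ⋖ ⋯ ⋖ x N` from the bottom to the top of `L`, with numberings
`j 0, …, j (N - 1)` of all the join-irreducible elements and `m 0, …, m (N - 1)` of all the
meet-irreducible elements such that
`x i = j 0 ⊔ ⋯ ⊔ j (i - 1) = m i ⊓ ⋯ ⊓ m (N - 1)` for every `i`
(an empty join is the bottom, an empty meet is the top). In an extremal lattice `N` is the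
length of `L`, and `x` is thus a longest chain. -/
structure GaloisNumbering (L : Type*) [Lattice L] (N : ℕ) where
  x : Fin (N + 1) → L
  covBy : ∀ i : Fin N, x i.castSucc ⋖ x i.succ
  j : Fin N ≃ JoinIrr L
  m : Fin N ≃ MeetIrr L
  isLUB : ∀ i : Fin (N + 1), IsLUB {y : L | ∃ k : Fin N, k.val < i.val ∧ y = (j k : L)} (x i)
  isGLB : ∀ i : Fin (N + 1), IsGLB {y : L | ∃ k : Fin N, i.val ≤ k.val ∧ y = (m k : L)} (x i)

/-- The edge relation of the Galois graph, a directed graph on the join-irreducible elements: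
`j a → j b` if `a ≠ b` and `j a` is not below `m b`. -/
def GaloisNumbering.edge {L : Type*} [Lattice L] {N : ℕ} (ν : GaloisNumbering L N)
    (p q : JoinIrr L) : Prop :=
  p ≠ q ∧ ¬ ((p : L) ≤ (ν.m (ν.j.symm q) : L))

/-- The `α`-arcs: pairs `(a, b)` of nodes with `a < b` that lie in different `α`-regions.
The nodes are numbered from `0` to `n - 1`, and `α.index a` is the region that contains `a`. -/
def AlphaArc {n : ℕ} (α : Composition n) : Type :=
  {w : Fin n × Fin n // w.1 < w.2 ∧ α.index w.1 ≠ α.index w.2}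

/-- The directed edges `w → w'` between different `α`-arcs `w = (a₁, b₁)` and `w' = (a₂, b₂)`. -/
def AlphaArc.edge {n : ℕ} (α : Composition n) (w w' : AlphaArc α) : Prop :=
  w ≠ w' ∧
    ((α.index w.1.1 = α.index w'.1.1 ∧
        w.1.1 ≤ w'.1.1 ∧ w'.1.1 < w'.1.2 ∧ w'.1.2 ≤ w.1.2) ∨
      (α.index w.1.1 ≠ α.index w'.1.1 ∧
        w'.1.1 < w.1.1 ∧ w.1.1 < w'.1.2 ∧ w'.1.2 ≤ w.1.2 ∧
        α.index w.1.1 ≠ α.index w'.1.2))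

/-- `L` is (a copy of) the parabolic Tamari lattice `Tam(α)`: an extremal lattice whose Galois
graph is isomorphic to the directed graph of `α`-arcs. -/
def IsParabolicTamari {n : ℕ} (α : Composition n) (L : Type*) [Lattice L] : Prop :=
  IsExtremalLattice L ∧
    ∃ (N : ℕ) (ν : GaloisNumbering L N), Nonempty (ν.edge ≃r AlphaArc.edge α)

/-- The largest part of a composition. -/
def maxPart {n : ℕ} (α : Composition n) : ℕ := Finset.univ.sup α.blocksFun

/-! Let `Rel` be the reflexive closure of the edge relation. Up to indexing, it is the relation `¬ j
w ≤ m w'` between join- and meet-irreducibles, and these separate the points of the lattice.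
Existence: `Rel` is triangular for a lexicographic order of the arcs, so the concept lattice of its
complement is extremal with the required Galois graph.

Upper bound: covering `Rel` by `d` Ferrers relations embeds the lattice into `ℝ^d`. Fix a largest
region `r`. If `w.Rel w'`, the source of `w` lies in an earlier region than the target of `w'`, so
that source is left of `r` or that target is right of `r`. Sorting the pairs by this node gives one
class per node outside `r`. Each class is Ferrers, because fixing the node leaves a single
comparison in a linear preorder (`ferrers_or`).

Lower bound: stack the regions as rows aligned at their first nodes and join each node to the next
one in its column. These arcs are pairwise unrelated (`IsColumnStep.not_rel`), so their irreducibles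
form a standard example, and only the last node of each column has no such arc. -/

section FiniteLattice

/-! ### Irreducibles of finite lattices -/

variable {L : Type*} [Lattice L]

theorem mem_joinIrr_of_forall_lt_le {j u : L} (hu : u < j) (h : ∀ z < j, z ≤ u) :
    j ∈ JoinIrr L := by
  refine ⟨u, ⟨hu, fun z hz hzj => (h z hzj).not_gt hz⟩, fun z hz => ?_⟩
  by_contra hne
  exact hz.2 (lt_of_le_of_ne (h z hz.1) hne) hu

theorem mem_meetIrr_of_forall_gt_le {m u : L} (hu : m < u) (h : ∀ z, m < z → u ≤ z) :
    m ∈ MeetIrr L := by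
  refine ⟨u, ⟨hu, fun z hz hzj => (h z hz).not_gt hzj⟩, fun z hz => ?_⟩
  by_contra hne
  exact hz.2 hu (lt_of_le_of_ne (h z hz.1) (Ne.symm hne))

theorem exists_forall_lt_le_of_mem_joinIrr [Finite L] {j : L} (hj : j ∈ JoinIrr L) :
    ∃ u < j, ∀ z < j, z ≤ u := by
  obtain ⟨u, hu, huniq⟩ := hj
  refine ⟨u, hu.1, fun z hz => ?_⟩
  obtain ⟨c, hzc, hc⟩ := exists_le_covBy_of_lt hz
  exact (huniq c hc) ▸ hzc

theorem exists_forall_gt_le_of_mem_meetIrr [Finite L] {m : L} (hm : m ∈ MeetIrr L) :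
    ∃ u, m < u ∧ ∀ z, m < z → u ≤ z := by
  obtain ⟨u, hu, huniq⟩ := hm
  refine ⟨u, hu.1, fun z hz => ?_⟩
  obtain ⟨c, hc, hcz⟩ := exists_covBy_le_of_lt hz
  exact (huniq c hc) ▸ hcz

/-- Take `j` minimal among the elements below `x` but not below `y`: everything strictly below `j`
is below `j ⊓ y`. -/
theorem exists_joinIrr_le_not_le [Finite L] {x y : L} (h : ¬ x ≤ y) :
    ∃ j ∈ JoinIrr L, j ≤ x ∧ ¬ j ≤ y := by
  obtain ⟨j, hj⟩ := (Set.toFinite {z : L | z ≤ x ∧ ¬ z ≤ y}).exists_minimal ⟨x, le_rfl, h⟩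
  refine ⟨j, mem_joinIrr_of_forall_lt_le (u := j ⊓ y) ?_ fun z hz => ?_, hj.prop⟩
  · exact lt_of_le_of_ne inf_le_left fun he => hj.prop.2 (inf_eq_left.1 he)
  · refine le_inf hz.le ?_
    by_contra hzy
    exact hz.not_ge (hj.le_of_le ⟨hz.le.trans hj.prop.1, hzy⟩ hz.le)

theorem exists_meetIrr_ge_not_ge [Finite L] {x y : L} (h : ¬ x ≤ y) :
    ∃ m ∈ MeetIrr L, y ≤ m ∧ ¬ x ≤ m := by
  obtain ⟨m, hm⟩ := (Set.toFinite {z : L | y ≤ z ∧ ¬ x ≤ z}).exists_maximal ⟨y, le_rfl, h⟩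
  refine ⟨m, mem_meetIrr_of_forall_gt_le (u := m ⊔ x) ?_ fun z hz => ?_, hm.prop⟩
  · exact lt_of_le_of_ne le_sup_left fun he => hm.prop.2 (sup_eq_left.1 he.symm)
  · refine sup_le hz.le ?_
    by_contra hzy
    exact hz.not_ge (hm.le_of_ge ⟨hm.prop.1.trans hz.le, hzy⟩ hz.le)

/-- Otherwise `j i` would lie below every `m l` with `l ≥ i`, hence below their meet `x i`, and the
chain would not grow at step `i`. -/
theorem GaloisNumbering.not_j_le_m {N : ℕ} (ν : GaloisNumbering L N) (i : Fin N) :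
    ¬ (ν.j i : L) ≤ (ν.m i : L) := by
  intro h
  refine (ν.covBy i).lt.not_ge ((ν.isLUB i.succ).2 ?_)
  rintro _ ⟨k, hk, rfl⟩
  rcases (Nat.lt_succ_iff.1 (by simpa using hk : k.val < i.val + 1)).lt_or_eq with hlt | heq
  · exact (ν.isLUB i.castSucc).1 ⟨k, by simpa using hlt, rfl⟩
  · obtain rfl : k = i := Fin.ext heq
    refine (ν.isGLB k.castSucc).2 ?_
    rintro _ ⟨l, hl, rfl⟩
    rcases (by simpa using hl : k.val ≤ l.val).lt_or_eq with hlt | heq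
    · refine ((ν.isLUB k.succ).1 ⟨k, by simp, rfl⟩).trans ((ν.isGLB k.succ).1 ⟨l, ?_, rfl⟩)
      simpa using hlt
    · obtain rfl : k = l := Fin.ext heq
      exact h

end FiniteLattice

/-! ### Bounds on the order dimension -/

section OrderDimension

/-- Finitely many Ferrers relations that cover the relation `¬ j v ≤ m w`, for families `j` and `m`
that separate the points of a poset, embed the poset into a power of `ℝ`. -/
theorem nonempty_orderEmbedding_of_ferrers {P V W ι : Type*} [PartialOrder P] [Finite W]
    [Fintype ι] (j : V → P) (m : W → P) (F : ι → V → W → Prop)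
    (hF : ∀ c v v' w w', F c v w → F c v' w' → F c v w' ∨ F c v' w)
    (hle : ∀ c v w, F c v w → ¬ j v ≤ m w)
    (hcov : ∀ x y : P, ¬ x ≤ y → ∃ c v w, F c v w ∧ j v ≤ x ∧ y ≤ m w) :
    Nonempty (P ↪o (Fin (Fintype.card ι) → ℝ)) := by
  -- The Ferrers condition makes the sets `U c x` nested for fixed `c`, so their cardinalities serve
  -- as the coordinate `c`.
  let U : ι → P → Set W := fun c x => {w | ∃ v, j v ≤ x ∧ F c v w}
  have hU : ∀ c, Monotone (U c) := fun c x y hxy w ⟨v, hv, hw⟩ => ⟨v, hv.trans hxy, hw⟩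
  let e := (Fintype.equivFin ι).symm
  refine ⟨OrderEmbedding.ofMapLEIff (fun x c => ((U (e c) x).ncard : ℝ)) fun x y => ⟨?_, ?_⟩⟩
  · intro h
    by_contra hxy
    obtain ⟨c, v, w, hvw, hv, hw⟩ := hcov x y hxy
    have hwy : w ∉ U c y := fun ⟨v', hv', hF'⟩ => hle c v' w hF' (hv'.trans hw)
    have hss : U c y ⊂ U c x := by
      refine (Set.ssubset_iff_of_subset ?_).2 ⟨w, ⟨v, hv, hvw⟩, hwy⟩
      rintro w' ⟨v', hv', hF'⟩
      rcases hF c v v' w w' hvw hF' with h1 | h1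
      · exact ⟨v, hv, h1⟩
      · exact absurd ⟨v', hv', h1⟩ hwy
    have h2 := h (e.symm c)
    simp only [Equiv.apply_symm_apply, Nat.cast_le] at h2
    exact (Set.ncard_lt_ncard hss (Set.toFinite _)).not_ge h2
  · intro h c
    exact Nat.cast_le.2 (Set.ncard_le_ncard (hU _ h) (Set.toFinite _))

/-- A family of pairs `¬ j s ≤ m s` with `j s ≤ m t` for `s ≠ t` bounds the dimension from below. -/
theorem card_le_of_orderEmbedding {P S : Type*} [PartialOrder P] [Fintype S] (j m : S → P)
    (h : ∀ s, ¬ j s ≤ m s) (hne : ∀ s t, s ≠ t → j s ≤ m t) {k : ℕ} (f : P ↪o (Fin k → ℝ)) :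
    Fintype.card S ≤ k := by
  have hc : ∀ s, ∃ c, f (m s) c < f (j s) c := by
    intro s
    by_contra hs
    push Not at hs
    exact h s (f.le_iff_le.1 hs)
  choose c hc using hc
  -- A coordinate shared by `s ≠ t` would give the cycle `j s ≤ m t < j t ≤ m s < j s` there.
  have hinj : Function.Injective c := by
    intro s t hst
    by_contra hne'
    have h1 : f (j s) (c s) ≤ f (m t) (c s) := f.monotone (hne s t hne') _
    have h2 : f (j t) (c s) ≤ f (m s) (c s) := f.monotone (hne t s (Ne.symm hne')) _
    have h3 := hc s
    have h4 := hc t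
    rw [← hst] at h4
    linarith
  simpa using Fintype.card_le_of_injective c hinj

end OrderDimension

/-! ### Extremal lattices from triangular relations -/

section Triangular

variable {L : Type*} [CompleteLattice L] {N : ℕ} {j m : Fin N → L}

/-- The data of a lattice that is join-generated by `j` and meet-generated by `m`, such that
`j i ≤ m l` for `i < l` and `¬ j i ≤ m i`. -/
structure IsTriangular (j m : Fin N → L) : Prop where
  le_of_forall_j : ∀ {x y : L}, (∀ i, j i ≤ x → j i ≤ y) → x ≤ y
  le_of_forall_m : ∀ {x y : L}, (∀ i, y ≤ m i → x ≤ m i) → x ≤ y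
  le_of_lt : ∀ {i l}, i < l → j i ≤ m l
  not_le : ∀ i, ¬ j i ≤ m i

namespace IsTriangular

theorem le_of_j_le_j (h : IsTriangular j m) {i l : Fin N} (hil : j i ≤ j l) : i ≤ l := by
  by_contra hlt
  exact h.not_le i (hil.trans (h.le_of_lt (lt_of_not_ge hlt)))

theorem le_of_m_le_m (h : IsTriangular j m) {i l : Fin N} (hil : m i ≤ m l) : i ≤ l := by
  by_contra hlt
  exact h.not_le l ((h.le_of_lt (lt_of_not_ge hlt)).trans hil)

theorem j_injective (h : IsTriangular j m) : Function.Injective j := fun _ _ he =>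
  le_antisymm (h.le_of_j_le_j he.le) (h.le_of_j_le_j he.ge)

theorem m_injective (h : IsTriangular j m) : Function.Injective m := fun _ _ he =>
  le_antisymm (h.le_of_m_le_m he.le) (h.le_of_m_le_m he.ge)

/-- Any `j k` below some `z < j i` has `k < i`, hence lies below `m i`; so `j i ⊓ m i` is the
largest element strictly below `j i`. -/
theorem j_mem (h : IsTriangular j m) (i : Fin N) : j i ∈ JoinIrr L := by
  refine mem_joinIrr_of_forall_lt_le (u := j i ⊓ m i) ?_ fun z hz => le_inf hz.le ?_
  · exact lt_of_le_of_ne inf_le_left fun he => h.not_le i (inf_eq_left.1 he)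
  · refine h.le_of_forall_j fun k hk => h.le_of_lt ?_
    refine lt_of_le_of_ne (h.le_of_j_le_j (hk.trans hz.le)) ?_
    rintro rfl
    exact hz.not_ge hk

theorem m_mem (h : IsTriangular j m) (i : Fin N) : m i ∈ MeetIrr L := by
  refine mem_meetIrr_of_forall_gt_le (u := m i ⊔ j i) ?_ fun z hz => sup_le hz.le ?_
  · exact lt_of_le_of_ne le_sup_left fun he => h.not_le i (sup_eq_left.1 he.symm)
  · refine h.le_of_forall_m fun k hk => h.le_of_lt ?_
    refine lt_of_le_of_ne (h.le_of_m_le_m (hz.le.trans hk)) ?_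
    rintro rfl
    exact hz.not_ge hk

theorem exists_j_eq [Finite L] (h : IsTriangular j m) {x : L} (hx : x ∈ JoinIrr L) :
    ∃ i, j i = x := by
  obtain ⟨u, hu, hlt⟩ := exists_forall_lt_le_of_mem_joinIrr hx
  by_contra hne
  push Not at hne
  exact hu.not_ge (h.le_of_forall_j fun i hi => hlt _ (lt_of_le_of_ne hi (hne i)))

theorem exists_m_eq [Finite L] (h : IsTriangular j m) {x : L} (hx : x ∈ MeetIrr L) :
    ∃ i, m i = x := by
  obtain ⟨u, hu, hlt⟩ := exists_forall_gt_le_of_mem_meetIrr hx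
  by_contra hne
  push Not at hne
  exact hu.not_ge (h.le_of_forall_m fun i hi => hlt _ (lt_of_le_of_ne hi (hne i).symm))

noncomputable def joinIrrEquiv [Finite L] (h : IsTriangular j m) : Fin N ≃ JoinIrr L :=
  Equiv.ofBijective (fun i => ⟨j i, h.j_mem i⟩)
    ⟨fun _ _ he => h.j_injective (congrArg Subtype.val he), fun ⟨_, hx⟩ =>
      (h.exists_j_eq hx).imp fun _ hi => Subtype.ext hi⟩

noncomputable def meetIrrEquiv [Finite L] (h : IsTriangular j m) : Fin N ≃ MeetIrr L :=
  Equiv.ofBijective (fun i => ⟨m i, h.m_mem i⟩)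
    ⟨fun _ _ he => h.m_injective (congrArg Subtype.val he), fun ⟨_, hx⟩ =>
      (h.exists_m_eq hx).imp fun _ hi => Subtype.ext hi⟩

/-- The join of the first `i` elements of the family `j`. -/
def chain (j : Fin N → L) (i : Fin (N + 1)) : L :=
  sSup {y | ∃ k : Fin N, k.val < i.val ∧ y = j k}

theorem j_le_chain {k : Fin N} {i : Fin (N + 1)} (hk : k.val < i.val) : j k ≤ chain j i :=
  le_sSup ⟨k, hk, rfl⟩

theorem chain_le_m (h : IsTriangular j m) {k : Fin N} {i : Fin (N + 1)} (hk : i.val ≤ k.val) :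
    chain j i ≤ m k := by
  refine sSup_le ?_
  rintro _ ⟨l, hl, rfl⟩
  exact h.le_of_lt (Fin.lt_def.2 (hl.trans_le hk))

theorem isGLB_chain (h : IsTriangular j m) (i : Fin (N + 1)) :
    IsGLB {y : L | ∃ k : Fin N, i.val ≤ k.val ∧ y = m k} (chain j i) := by
  constructor
  · rintro _ ⟨k, hk, rfl⟩
    exact h.chain_le_m hk
  · intro z hz
    refine h.le_of_forall_j fun l hl => j_le_chain ?_
    by_contra hlt
    exact h.not_le l (hl.trans (hz ⟨l, not_lt.1 hlt, rfl⟩))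

theorem chain_covBy (h : IsTriangular j m) (i : Fin N) :
    chain j i.castSucc ⋖ chain j i.succ := by
  constructor
  · refine lt_of_le_not_ge (sSup_le ?_) fun hle => ?_
    · rintro _ ⟨k, hk, rfl⟩
      exact j_le_chain (by simp at hk ⊢; lia)
    · exact h.not_le i ((j_le_chain (by simp)).trans (hle.trans (h.chain_le_m (by simp))))
  · intro z hz hz'
    -- An element `j l ≤ z` has `l ≤ i`, and `l = i` would put the whole upper end of the step below
    -- `z`.
    refine hz.not_ge (h.le_of_forall_j fun l hl => j_le_chain ?_)
    by_contra hlt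
    have hli : i.val ≤ l.val := by simpa using hlt
    rcases hli.lt_or_eq with hli | hli
    · exact h.not_le l (hl.trans (hz'.le.trans (h.chain_le_m (by simpa using hli))))
    · obtain rfl : i = l := Fin.ext hli
      refine hz'.not_ge (sSup_le ?_)
      rintro _ ⟨k, hk, rfl⟩
      rcases (Nat.lt_succ_iff.1 (by simpa using hk : k.val < i.val + 1)).lt_or_eq with hk | hk
      · exact (j_le_chain (by simpa using hk)).trans hz.le
      · obtain rfl : k = i := Fin.ext hk
        exact hl

/-- The numbering of the irreducibles given by the families `j` and `m`. -/
noncomputable def galoisNumbering [Finite L] (h : IsTriangular j m) : GaloisNumbering L N where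
  x := chain j
  covBy := h.chain_covBy
  j := h.joinIrrEquiv
  m := h.meetIrrEquiv
  isLUB _ := isLUB_sSup _
  isGLB := h.isGLB_chain

theorem krullDim_eq (h : IsTriangular j m) : Order.krullDim L = (N : ℕ∞) := by
  apply le_antisymm
  -- The number of `j i` below `x` strictly increases with `x` and is at most `N`.
  · have hmono : StrictMono fun x : L =>
        (⟨{i | j i ≤ x}.ncard, Nat.lt_succ_iff.2
          ((Set.ncard_le_card _).trans (by simp))⟩ : Fin (N + 1)) := by
      intro x y hxy
      refine Fin.lt_def.2 (Set.ncard_lt_ncard ?_ (Set.toFinite _))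
      refine ⟨fun i hi => le_trans hi hxy.le, fun hsub => hxy.not_ge ?_⟩
      exact h.le_of_forall_j fun i hi => hsub hi
    refine (Order.krullDim_le_of_strictMono _ hmono).trans (iSup_le fun p => ?_)
    have := p.length_lt_card
    rw [Fintype.card_fin] at this
    exact_mod_cast Nat.lt_succ_iff.1 this
  · let p : LTSeries L := ⟨N, chain j, fun i => (h.chain_covBy i).lt⟩
    exact Order.LTSeries.length_le_krullDim p

theorem isExtremalLattice [Finite L] (h : IsTriangular j m) : IsExtremalLattice L := by
  have hJ : (JoinIrr L).ncard = N := by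
    rw [← Nat.card_coe_set_eq, ← Nat.card_congr h.joinIrrEquiv, Nat.card_fin]
  have hM : (MeetIrr L).ncard = N := by
    rw [← Nat.card_coe_set_eq, ← Nat.card_congr h.meetIrrEquiv, Nat.card_fin]
  rw [IsExtremalLattice, hJ, hM]
  exact ⟨h.krullDim_eq, h.krullDim_eq⟩

end IsTriangular

end Triangular

/-- Every reflexive triangular relation is the relation `¬ j i ≤ m l` of a finite lattice. -/
theorem exists_isTriangular {N : ℕ} (R : Fin N → Fin N → Prop) (hrefl : ∀ i, R i i)
    (htri : ∀ i l, R i l → l ≤ i) :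
    ∃ (T : Type) (_ : CompleteLattice T) (j m : Fin N → T),
      Finite T ∧ IsTriangular j m ∧ ∀ i l, R i l ↔ ¬ j i ≤ m l := by
  -- In the concept lattice of `r`, an object concept lies below an attribute concept exactly when
  -- `r` holds, hence the negation.
  let r : Fin N → Fin N → Prop := fun i l => ¬ R i l
  have hj : ∀ i (x : Concept (Fin N) (Fin N) r), Concept.ofObject r i ≤ x ↔ i ∈ x.extent := by
    simp
  have hm : ∀ l (x : Concept (Fin N) (Fin N) r), x ≤ Concept.ofAttribute r l ↔ l ∈ x.intent := by
    simp
  refine ⟨Concept (Fin N) (Fin N) r, inferInstance, Concept.ofObject r, Concept.ofAttribute r,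
    Finite.of_injective _ Concept.extent_injective, ⟨?_, ?_, ?_, ?_⟩, ?_⟩
  · intro x y h
    rw [← Concept.extent_subset_extent_iff]
    exact fun i hi => (hj i y).1 (h i ((hj i x).2 hi))
  · intro x y h
    rw [← Concept.intent_subset_intent_iff]
    exact fun i hi => (hm i x).1 (h i ((hm i y).2 hi))
  · exact fun {i l} hil => Concept.ofObject_le_ofAttribute_iff.2 fun hR => hil.not_ge (htri i l hR)
  · exact fun i hle => Concept.ofObject_le_ofAttribute_iff.1 hle (hrefl i)
  · exact fun i l => by rw [Concept.ofObject_le_ofAttribute_iff, not_not]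

/-! ### Regions of a composition and positions in them -/

section Composition

variable {n : ℕ} (α : Composition n)

/-- The position of a node in its region. -/
def regionPos (a : Fin n) : ℕ := α.invEmbedding a

variable {α}

theorem regionPos_lt (a : Fin n) : regionPos α a < α.blocksFun (α.index a) :=
  (α.invEmbedding a).2

theorem sizeUpTo_index_add_regionPos (a : Fin n) :
    α.sizeUpTo (α.index a) + regionPos α a = a := by
  rw [regionPos, Composition.coe_invEmbedding]
  exact Nat.add_sub_cancel' (α.sizeUpTo_index_le a)

theorem lt_of_index_lt {a b : Fin n} (h : α.index a < α.index b) : a < b := by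
  have h1 := α.lt_sizeUpTo_index_succ a
  have h2 := α.sizeUpTo_index_le b
  have h3 := α.monotone_sizeUpTo (Nat.succ_le_of_lt (Fin.lt_def.1 h))
  exact Fin.lt_def.2 (h1.trans_le (h3.trans h2))

theorem index_le_of_le {a b : Fin n} (h : a ≤ b) : α.index a ≤ α.index b := by
  by_contra hlt
  exact h.not_gt (lt_of_index_lt (lt_of_not_ge hlt))

theorem lt_iff_regionPos_lt {a b : Fin n} (h : α.index a = α.index b) :
    a < b ↔ regionPos α a < regionPos α b := by
  rw [Fin.lt_def, ← sizeUpTo_index_add_regionPos (α := α) a,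
    ← sizeUpTo_index_add_regionPos (α := α) b, h, Nat.add_lt_add_iff_left]

theorem eq_of_index_eq_of_regionPos_eq {a b : Fin n} (h : α.index a = α.index b)
    (hpos : regionPos α a = regionPos α b) : a = b := by
  rw [Fin.ext_iff, ← sizeUpTo_index_add_regionPos (α := α) a,
    ← sizeUpTo_index_add_regionPos (α := α) b, h, hpos]

theorem exists_index_eq_regionPos_eq {r : Fin α.length} {i : ℕ} (hi : i < α.blocksFun r) :
    ∃ a, α.index a = r ∧ regionPos α a = i := by
  have h := α.index_embedding r ⟨i, hi⟩
  refine ⟨α.embedding r ⟨i, hi⟩, h, ?_⟩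
  have h1 := sizeUpTo_index_add_regionPos (α := α) (α.embedding r ⟨i, hi⟩)
  rw [h, Composition.coe_embedding] at h1
  exact Nat.add_left_cancel h1

theorem blocksFun_le_maxPart (r : Fin α.length) : α.blocksFun r ≤ maxPart α :=
  Finset.le_sup (f := α.blocksFun) (Finset.mem_univ r)

theorem exists_blocksFun_eq_maxPart (hn : 0 < n) (α : Composition n) :
    ∃ r, α.blocksFun r = maxPart α := by
  have : Nonempty (Fin α.length) := ⟨α.index ⟨0, hn⟩⟩
  obtain ⟨r, -, hr⟩ := Finset.exists_mem_eq_sup Finset.univ Finset.univ_nonempty α.blocksFun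
  exact ⟨r, hr.symm⟩

theorem card_index_ne (r : Fin α.length) :
    Fintype.card {a : Fin n // α.index a ≠ r} = n - α.blocksFun r := by
  have h : Fintype.card {a : Fin n // α.index a = r} = α.blocksFun r := by
    rw [← Fintype.card_fin (α.blocksFun r)]
    refine Fintype.card_congr (Equiv.ofBijective
      (fun a => (⟨regionPos α a.1, (regionPos_lt a.1).trans_eq (congrArg _ a.2)⟩ : Fin (α.blocksFun r))) ⟨?_, ?_⟩)
    · intro a b hab
      exact Subtype.ext (eq_of_index_eq_of_regionPos_eq (a.2.trans b.2.symm)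
        (congrArg Fin.val hab))
    · intro i
      obtain ⟨a, ha, hi⟩ := exists_index_eq_regionPos_eq i.2
      exact ⟨⟨a, ha⟩, Fin.ext hi⟩
  rw [Fintype.card_subtype_compl, h, Fintype.card_fin]

end Composition

/-! ### The relation on arcs and its Galois realization -/

section AlphaArc

variable {n : ℕ} {α : Composition n}

theorem AlphaArc.index_lt (w : AlphaArc α) : α.index w.1.1 < α.index w.1.2 :=
  lt_of_le_of_ne (index_le_of_le w.2.1.le) w.2.2

/-- The reflexive closure of the edge relation on `α`-arcs. -/
def AlphaArc.Rel (w w' : AlphaArc α) : Prop :=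
  (α.index w'.1.1 < α.index w.1.1 ∨ α.index w'.1.1 = α.index w.1.1 ∧ w.1.1 ≤ w'.1.1) ∧
    w'.1.2 ≤ w.1.2 ∧ α.index w.1.1 < α.index w'.1.2

theorem AlphaArc.Rel.refl (w : AlphaArc α) : w.Rel w :=
  ⟨Or.inr ⟨rfl, le_rfl⟩, le_rfl, w.index_lt⟩

theorem AlphaArc.edge_iff (w w' : AlphaArc α) : AlphaArc.edge α w w' ↔ w ≠ w' ∧ w.Rel w' := by
  refine and_congr_right fun _ => ⟨?_, ?_⟩
  · rintro (⟨h1, h2, -, h4⟩ | ⟨h1, h2, h3, h4, h5⟩)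
    · exact ⟨Or.inr ⟨h1.symm, h2⟩, h4, h1 ▸ w'.index_lt⟩
    · exact ⟨Or.inl (lt_of_le_of_ne (index_le_of_le h2.le) h1.symm), h4,
        lt_of_le_of_ne (index_le_of_le h3.le) h5⟩
  · rintro ⟨h1 | ⟨h1, h2⟩, h3, h4⟩
    · exact Or.inr ⟨h1.ne', lt_of_index_lt h1, lt_of_index_lt h4, h3, h4.ne⟩
    · exact Or.inl ⟨h1.symm, h2, w'.2.1, h3⟩

instance : Finite (AlphaArc α) := inferInstanceAs (Finite (Subtype _))

/-- The arcs can be numbered such that `Rel` does not increase the number. -/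
theorem AlphaArc.exists_equiv_fin (α : Composition n) :
    ∃ (N : ℕ) (e : AlphaArc α ≃ Fin N), ∀ w w', w.Rel w' → e w' ≤ e w := by
  -- `Rel` moves to an earlier source region, or within the region to a source further right, or
  -- keeps the source and does not increase the target; so the source is compared in reverse.
  let key : AlphaArc α → Fin α.length ×ₗ (Fin n)ᵒᵈ ×ₗ Fin n := fun w =>
    toLex (α.index w.1.1, toLex (OrderDual.toDual w.1.1, w.1.2))
  have hkey : Function.Injective key := by
    intro w w' h
    simp only [key, EmbeddingLike.apply_eq_iff_eq, Prod.mk.injEq] at h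
    exact Subtype.ext (Prod.ext h.2.1 h.2.2)
  let : LinearOrder (AlphaArc α) := LinearOrder.lift' key hkey
  have := Fintype.ofFinite (AlphaArc α)
  let e := (Fintype.orderIsoFinOfCardEq (AlphaArc α) rfl).symm
  refine ⟨_, e.toEquiv, fun w w' h => e.monotone ?_⟩
  change key w' ≤ key w
  obtain ⟨h1 | ⟨h1, h2⟩, h3, -⟩ := h
  · exact Prod.Lex.toLex_le_toLex.2 (Or.inl h1)
  · refine Prod.Lex.toLex_le_toLex.2 (Or.inr ⟨h1, Prod.Lex.toLex_le_toLex.2 ?_⟩)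
    rcases h2.lt_or_eq with h2 | h2
    · exact Or.inl h2
    · exact Or.inr ⟨congrArg OrderDual.toDual h2.symm, h3⟩

theorem exists_isParabolicTamari (α : Composition n) :
    ∃ (T : Type) (_ : Lattice T), Finite T ∧ IsParabolicTamari α T := by
  obtain ⟨N, e, he⟩ := AlphaArc.exists_equiv_fin α
  obtain ⟨T, _, j, m, hT, h, hR⟩ := exists_isTriangular
    (fun i l => (e.symm i).Rel (e.symm l)) (fun i => .refl _)
    (fun i l hil => by simpa using he _ _ hil)
  refine ⟨T, inferInstance, hT, h.isExtremalLattice, N, h.galoisNumbering, ⟨?_⟩⟩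
  refine ⟨(e.trans h.joinIrrEquiv).symm, ?_⟩
  intro p q
  obtain ⟨i, rfl⟩ := h.joinIrrEquiv.surjective p
  obtain ⟨l, rfl⟩ := h.joinIrrEquiv.surjective q
  rw [AlphaArc.edge_iff, GaloisNumbering.edge]
  have hl : h.galoisNumbering.j.symm (h.joinIrrEquiv l) = l := h.joinIrrEquiv.symm_apply_apply l
  rw [hl]
  simp only [Equiv.symm_trans_apply, Equiv.symm_apply_apply, ne_eq, EmbeddingLike.apply_eq_iff_eq]
  exact and_congr_right fun _ => hR i l

/-- The irreducibles of a parabolic Tamari lattice, as families indexed by the arcs. -/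
theorem IsParabolicTamari.exists_irreducibles {L : Type*} [Lattice L] [Finite L]
    (h : IsParabolicTamari α L) :
    ∃ j m : AlphaArc α → L, (∀ w w', w.Rel w' ↔ ¬ j w ≤ m w') ∧
      ∀ x y, ¬ x ≤ y → ∃ w w', w.Rel w' ∧ j w ≤ x ∧ y ≤ m w' := by
  obtain ⟨-, N, ν, ⟨f⟩⟩ := h
  have hrel : ∀ w w' : AlphaArc α, w.Rel w' ↔
      ¬ (f.symm w : L) ≤ (ν.m (ν.j.symm (f.symm w')) : L) := by
    intro w w'
    by_cases hw : w = w'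
    -- The Galois graph has no loops, so the diagonal needs `not_j_le_m`.
    · subst hw
      have := ν.not_j_le_m (ν.j.symm (f.symm w))
      rw [Equiv.apply_symm_apply] at this
      exact iff_of_true (.refl w) this
    · have h1 := f.symm.map_rel_iff (a := w) (b := w')
      rw [AlphaArc.edge_iff, GaloisNumbering.edge] at h1
      have h2 : f.symm w ≠ f.symm w' := fun he => hw (f.symm.injective he)
      simpa [hw, h2] using h1.symm
  refine ⟨fun w => f.symm w, fun w => ν.m (ν.j.symm (f.symm w)), hrel, fun x y hxy => ?_⟩
  obtain ⟨p, hp, hpx, hpy⟩ := exists_joinIrr_le_not_le hxy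
  obtain ⟨q, hq, hyq, hpq⟩ := exists_meetIrr_ge_not_ge hpy
  have hj : (f.symm (f ⟨p, hp⟩) : L) = p := by simp
  have hm : (ν.m (ν.j.symm (f.symm (f (ν.j (ν.m.symm ⟨q, hq⟩))))) : L) = q := by simp
  refine ⟨f ⟨p, hp⟩, f (ν.j (ν.m.symm ⟨q, hq⟩)), (hrel _ _).2 ?_, ?_, ?_⟩
  · rwa [hj, hm]
  · exact hj.trans_le hpx
  · exact hyq.trans_eq hm.symm

/-! ### Covering the relation by Ferrers relations -/

/-- The Ferrers relation of the node `c`: the pairs of `Rel` with source `c` in the first arc if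
`c` is to the left of the region `r`, and with target `c` in the second arc otherwise. -/
def AlphaArc.ferrers (r : Fin α.length) (c : {a : Fin n // α.index a ≠ r})
    (w w' : AlphaArc α) : Prop :=
  w.Rel w' ∧ (α.index c.1 < r ∧ w.1.1 = c ∨ r < α.index c.1 ∧ w'.1.2 = c)

theorem AlphaArc.ferrers_or (r : Fin α.length) (c : {a : Fin n // α.index a ≠ r})
    (v v' w w' : AlphaArc α) (h : ferrers r c v w) (h' : ferrers r c v' w') :
    ferrers r c v w' ∨ ferrers r c v' w := by
  obtain ⟨⟨h1, h2, h3⟩, ⟨hc, h4⟩ | ⟨hc, h4⟩⟩ := h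
  · obtain ⟨⟨h1', h2', h3'⟩, ⟨-, h4'⟩ | ⟨hc', -⟩⟩ := h'
    · simp only [ferrers, Rel]
      rw [h4] at h1 h3 ⊢
      rw [h4'] at h1' h3' ⊢
      -- With the source fixed, the only condition involving both arcs is the comparison of targets;
      -- the first arc with the larger target is related to both `w` and `w'`.
      rcases le_total v.1.2 v'.1.2 with hle | hle
      · exact Or.inr ⟨⟨h1, h2.trans hle, h3⟩, Or.inl ⟨hc, rfl⟩⟩
      · exact Or.inl ⟨⟨h1', h2'.trans hle, h3'⟩, Or.inl ⟨hc, rfl⟩⟩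
    · exact absurd hc hc'.not_gt
  · obtain ⟨⟨h1', h2', h3'⟩, ⟨hc', -⟩ | ⟨-, h4'⟩⟩ := h'
    · exact absurd hc hc'.not_gt
    · simp only [ferrers, Rel]
      rw [h4] at h2 h3 ⊢
      rw [h4'] at h2' h3' ⊢
      -- With the target fixed, only sources are compared, in a total preorder: regions reversed,
      -- then nodes in order. If both exchanges failed, the sources would form a cycle.
      have key : (α.index w'.1.1 < α.index v.1.1 ∨
            α.index w'.1.1 = α.index v.1.1 ∧ v.1.1 ≤ w'.1.1) ∨
          (α.index w.1.1 < α.index v'.1.1 ∨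
            α.index w.1.1 = α.index v'.1.1 ∧ v'.1.1 ≤ w.1.1) := by
        lia
      rcases key with key | key
      · exact Or.inl ⟨⟨key, h2, h3⟩, Or.inr ⟨hc, rfl⟩⟩
      · exact Or.inr ⟨⟨key, h2', h3'⟩, Or.inr ⟨hc, rfl⟩⟩

theorem AlphaArc.Rel.exists_ferrers (r : Fin α.length) {w w' : AlphaArc α} (h : w.Rel w') :
    ∃ c, ferrers r c w w' := by
  rcases lt_or_ge (α.index w.1.1) r with hlt | hge
  · exact ⟨⟨w.1.1, hlt.ne⟩, h, Or.inl ⟨hlt, rfl⟩⟩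
  · have := hge.trans_lt h.2.2
    exact ⟨⟨w'.1.2, this.ne'⟩, h, Or.inr ⟨this, rfl⟩⟩

/-! ### Column steps and the lower bound -/

/-- An arc that joins two nodes in the same position of their regions, such that no region in
between has a node in this position. -/
def AlphaArc.IsColumnStep (w : AlphaArc α) : Prop :=
  regionPos α w.1.2 = regionPos α w.1.1 ∧
    ∀ r, α.index w.1.1 < r → r < α.index w.1.2 → α.blocksFun r ≤ regionPos α w.1.1

/-- If `w.Rel w'`, the source of `w` shares the region of the source of `w'` or lies in a region
that `w'` skips; either way `w` has the smaller position. Then the target of `w'` can neither lie in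
a region skipped by `w` nor, in the region of the target of `w`, be at or left of that target. -/
theorem AlphaArc.IsColumnStep.not_rel {w w' : AlphaArc α} (hw : w.IsColumnStep)
    (hw' : w'.IsColumnStep) (hne : w.1.1 ≠ w'.1.1) : ¬ w.Rel w' := by
  rintro ⟨h1, h2, h3⟩
  have hpos : regionPos α w.1.1 < regionPos α w'.1.1 := by
    rcases h1 with h1 | ⟨h1, h4⟩
    · exact (regionPos_lt _).trans_le (hw'.2 _ h1 h3)
    · exact (lt_iff_regionPos_lt h1.symm).1 (lt_of_le_of_ne h4 hne)
  rcases (index_le_of_le (α := α) h2).lt_or_eq with hlt | heq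
  · have h4 := hw.2 _ h3 hlt
    have h5 := regionPos_lt (α := α) w'.1.2
    have h6 := hw'.1
    lia
  · refine h2.not_gt ((lt_iff_regionPos_lt heq.symm).2 ?_)
    rwa [hw.1, hw'.1]

/-- The nodes that are not the last one in their position. -/
def IsColumnSource (α : Composition n) (a : Fin n) : Prop :=
  ∃ b, α.index a < α.index b ∧ regionPos α b = regionPos α a

theorem IsColumnSource.exists_arc {a : Fin n} (h : IsColumnSource α a) :
    ∃ w : AlphaArc α, w.1.1 = a ∧ w.IsColumnStep := by
  -- The leftmost later node in the same position: minimality excludes this position from the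
  -- regions in between.
  obtain ⟨b, hb⟩ := (Set.toFinite
    {b | α.index a < α.index b ∧ regionPos α b = regionPos α a}).exists_minimal h
  refine ⟨⟨(a, b), lt_of_index_lt hb.prop.1, hb.prop.1.ne⟩, rfl, hb.prop.2, fun r hr hrb => ?_⟩
  by_contra hlt
  obtain ⟨c, rfl, hc⟩ := exists_index_eq_regionPos_eq (lt_of_not_ge hlt)
  have hcb := lt_of_index_lt hrb
  exact hcb.not_ge (hb.le_of_le ⟨hr, hc⟩ hcb.le)

open scoped Classical in
-- Nodes that are not column sources have distinct positions, all less than `maxPart α`.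
theorem sub_maxPart_le_card_isColumnSource (α : Composition n) :
    n - maxPart α ≤ Fintype.card {a // IsColumnSource α a} := by
  have h : Fintype.card {a // ¬ IsColumnSource α a} ≤ maxPart α := by
    rw [← Fintype.card_fin (maxPart α)]
    refine Fintype.card_le_of_injective (fun a =>
      ⟨regionPos α a.1, (regionPos_lt a.1).trans_le (blocksFun_le_maxPart _)⟩) ?_
    rintro ⟨a, ha⟩ ⟨b, hb⟩ hab
    have hpos : regionPos α a = regionPos α b := congrArg Fin.val hab
    rcases lt_trichotomy (α.index a) (α.index b) with hlt | heq | hlt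
    · exact absurd ⟨b, hlt, hpos.symm⟩ ha
    · exact Subtype.ext (eq_of_index_eq_of_regionPos_eq heq hpos)
    · exact absurd ⟨a, hlt, hpos⟩ hb
  rw [Fintype.card_subtype_compl, Fintype.card_fin] at h
  lia

end AlphaArc

theorem IsParabolicTamari.hasOrderDimension {n : ℕ} (hn : 0 < n) {α : Composition n} {L : Type*}
    [Lattice L] [Finite L] (h : IsParabolicTamari α L) :
    HasOrderDimension L (n - maxPart α) := by
  classical
  obtain ⟨j, m, hrel, hsep⟩ := h.exists_irreducibles
  constructor
  · obtain ⟨r, hr⟩ := exists_blocksFun_eq_maxPart hn α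
    rw [← hr, ← card_index_ne r]
    refine nonempty_orderEmbedding_of_ferrers j m (AlphaArc.ferrers r) (AlphaArc.ferrers_or r)
      (fun c v w hvw => (hrel v w).1 hvw.1) fun x y hxy => ?_
    obtain ⟨v, w, hvw, hv, hw⟩ := hsep x y hxy
    obtain ⟨c, hc⟩ := hvw.exists_ferrers r
    exact ⟨c, v, w, hc, hv, hw⟩
  · rintro k ⟨f⟩
    choose arc harc hstep using fun a : {a // IsColumnSource α a} => a.2.exists_arc
    refine (sub_maxPart_le_card_isColumnSource α).trans
      (card_le_of_orderEmbedding (fun a => j (arc a)) (fun a => m (arc a))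
        (fun a => (hrel _ _).1 (.refl _)) (fun a b hab => ?_) f)
    by_contra hle
    refine (hstep a).not_rel (hstep b) ?_ ((hrel _ _).2 hle)
    rw [harc, harc]
    exact fun he => hab (Subtype.ext he)

theorem mainTheorem9 {n : ℕ} (hn : 0 < n) (α : Composition n) :
    (∃ (T : Type) (_ : Lattice T), Finite T ∧ IsParabolicTamari α T) ∧
    ∀ (L : Type*) [Lattice L] [Finite L], IsParabolicTamari α L →
      HasOrderDimension L (n - maxPart α) :=
  ⟨exists_isParabolicTamari α, fun _ _ _ h => h.hasOrderDimension hn⟩
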